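/- **Theorem.** Let $d\in\mathbb N$ and let $\mathcal D_1,\mathcal D_2$ be arbitrary nonempty compact sets of density matrices (positive semidefinite, unit trace) on $\mathbb C^d$. Let $F(\rho,\sigma)=\|\sqrt\rho\sqrt\sigma\|_1$ be the (square root) Uhlmann fidelity, with $\|A\|_1=\operatorname{tr}\sqrt{A^\dagger A}$, let $d_B(\rho,\sigma)=\sqrt{2(1-F(\rho,\sigma))}$ be the Bures distance, and put $F_{\max}=\sup_{\rho_1\in\mathcal D_1,\rho_2\in\mathcal D_2}F(\rho_1,\rho_2)$. For $p\in(0,1)$ and an integer $n\ge 1$ define the min-max expected error probability $$P_{e,\min}(n)=\inf_{0\preceq\Pi\preceq I}\ \sup_{\rho_1\in\mathcal D_1,\rho_2\in\mathcal D_2}\Bigl[p\operatorname{tr}\bigl((I-\Pi)\rho_1^{\otimes n}\bigr)+(1-p)\operatorname{tr}\bigl(\Pi\rho_2^{\otimes n}\bigr)\Bigr],$$ where $\Pi$ ranges over operators on $(\mathbb C^d)^{\otimes n}$, and the sample complexity $n^\ast(\delta)=\inf\{n\ge 1: P_{e,\min}(n)\le\delta\}\in\mathbb N\cup\{+\infty\}$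 (with $\inf\emptyset=+\infty$). Then for all $p\in(0,1)$ and $\delta\in(0,\tfrac12]$, $$\max\left\{\frac{\ln\left(\frac{p(1-p)}{\delta}\right)}{-2\ln F_{\max}},\ \frac{1-\frac{\delta(1-\delta)}{p(1-p)}}{\inf_{\rho_1\in\mathcal D_1,\rho_2\in\mathcal D_2}d_B^2(\rho_1,\rho_2)}\right\}\le n^\ast(\delta).$$ Here the quotients are taken in the extended reals: $-2\ln 0=+\infty$, $a/(+\infty)=0$ for real $a$, and $a/0=+\infty$ if $a>0$, $a/0=0$ if $a\le0$. In particular, if $F_{\max}=1$ and one of the numerators is positive, then $n^\ast(\delta)=+\infty$. -/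

import Mathlib

namespace CompositeQHT

noncomputable section

open scoped MatrixOrder ComplexOrder

/-- Density matrices on a finite-dimensional Hilbert space: positive semidefinite, trace one. -/
def IsState {ι : Type*} [Fintype ι] (ρ : Matrix ι ι ℂ) : Prop :=
  ρ.PosSemidef ∧ ρ.trace = 1

/-- The `n`-fold tensor (Kronecker) power of a matrix, in the product basis indexed by
`Fin n → ι`. -/
def tensorPower {ι : Type*} (ρ : Matrix ι ι ℂ) (n : ℕ) :
    Matrix (Fin n → ι) (Fin n → ι) ℂ :=
  Matrix.of fun x y => ∏ k, ρ (x k) (y k)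

/-- The trace norm, the trace of the positive square root of `Aᴴ A`. -/
def traceNorm {ι : Type*} [Fintype ι] [DecidableEq ι] (A : Matrix ι ι ℂ) : ℝ :=
  (CFC.sqrt (A.conjTranspose * A)).trace.re

/-- The (square root) Uhlmann fidelity. -/
def fidelity {ι : Type*} [Fintype ι] [DecidableEq ι] (ρ σ : Matrix ι ι ℂ) : ℝ :=
  traceNorm (CFC.sqrt ρ * CFC.sqrt σ)

/-- The Bures distance. -/
def buresDist {ι : Type*} [Fintype ι] [DecidableEq ι] (ρ σ : Matrix ι ι ℂ) : ℝ :=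
  Real.sqrt (2 * (1 - fidelity ρ σ))

/-- The effects `0 ≤ E ≤ I`, each of which gives the two-outcome POVM `{E, I - E}`. -/
def Effect (ι : Type*) [Fintype ι] [DecidableEq ι] : Type _ :=
  {E : Matrix ι ι ℂ // E.PosSemidef ∧ (1 - E).PosSemidef}

/-- The expected error probability of the test `{E, I - E}` for the states `ρ₁` (guessed on
outcome `E`, prior `p`) and `ρ₂` (prior `1 - p`). -/
def errorProb {ι : Type*} [Fintype ι] [DecidableEq ι] (E : Effect ι) (p : ℝ)
    (ρ₁ ρ₂ : Matrix ι ι ℂ) : ℝ :=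
  p * ((1 - E.1) * ρ₁).trace.re + (1 - p) * (E.1 * ρ₂).trace.re

/-- The worst-case expected error probability of a test on `n` copies of a state. -/
def compositeErrorProb {ι : Type*} [Fintype ι] [DecidableEq ι] (n : ℕ) (E : Effect (Fin n → ι))
    (p : ℝ) (D₁ D₂ : Set (Matrix ι ι ℂ)) : ℝ :=
  ⨆ r : D₁ × D₂, errorProb E p (tensorPower r.1.1 n) (tensorPower r.2.1 n)

/-- The min-max expected error probability on `n` copies. -/
def minErrorProb {ι : Type*} [Fintype ι] [DecidableEq ι] (n : ℕ) (p : ℝ)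
    (D₁ D₂ : Set (Matrix ι ι ℂ)) : ℝ :=
  ⨅ E : Effect (Fin n → ι), compositeErrorProb n E p D₁ D₂

/-- The sample complexity: the least number `n ≥ 1` of copies for which the min-max expected
error probability is at most `δ`, and `⊤` if there is none. -/
def sampleComplexity {ι : Type*} [Fintype ι] [DecidableEq ι] (p : ℝ)
    (D₁ D₂ : Set (Matrix ι ι ℂ)) (δ : ℝ) : ℕ∞ :=
  sInf {N : ℕ∞ | ∃ n : ℕ, 1 ≤ n ∧ minErrorProb n p D₁ D₂ ≤ δ ∧ N = n}

/-- The maximum fidelity between states of the two sets. -/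
def maxFidelity {ι : Type*} [Fintype ι] [DecidableEq ι] (D₁ D₂ : Set (Matrix ι ι ℂ)) : ℝ :=
  ⨆ r : D₁ × D₂, fidelity r.1.1 r.2.1

/-- The infimum of the squared Bures distance between states of the two sets. -/
def infSqBuresDist {ι : Type*} [Fintype ι] [DecidableEq ι] (D₁ D₂ : Set (Matrix ι ι ℂ)) : ℝ :=
  ⨅ r : D₁ × D₂, buresDist r.1.1 r.2.1 ^ 2

/-- The quotient `a / b` in the extended reals for `0 ≤ b ≤ ⊤`, with `a / 0 = ⊤` for `0 < a`
(and, as in `EReal`, `a / 0 = 0` for `a ≤ 0` and `a / ⊤ = 0`). -/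
def extDiv (a : ℝ) (b : EReal) : EReal :=
  if b = 0 ∧ 0 < a then ⊤ else (a : EReal) / b

/-- The logarithm of a nonnegative real as an extended real, with `ln 0 = ⊥`. -/
def extLog (x : ℝ) : EReal :=
  ENNReal.log (ENNReal.ofReal x)

end

end CompositeQHT

namespace CompositeQHT

open scoped MatrixOrder ComplexOrder
open Matrix

/-! ### Tensor powers. -/

section TensorPower

variable {ι : Type*}

/-! Everything rests on `p * (1 - p) * F ^ (2 * n) ≤ e * (1 - e)` for the error `e` of any test on
`n` copies of a pair of states with fidelity `F` (`prior_mul_fidelity_pow_le`). Write `F = tr (V √ρ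
√σ)` with a partial isometry `V`; its tensor power gives `F ^ n`. Inserting `1 = E + (1 - E)` splits
`F ^ n` into two terms, and Cauchy–Schwarz bounds each by the two error probabilities.

An error of at most `δ ≤ 1 / 2` then forces `p * (1 - p) * F ^ (2 * n) ≤ δ * (1 - δ)` for every
pair. Logarithms give the first lower bound on `n`, Bernoulli's inequality the second. -/

theorem tensorPower_apply (A : Matrix ι ι ℂ) (n : ℕ) (x y : Fin n → ι) :
    tensorPower A n x y = ∏ k, A (x k) (y k) := rfl

theorem tensorPower_conjTranspose (A : Matrix ι ι ℂ) (n : ℕ) :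
    (tensorPower A n)ᴴ = tensorPower Aᴴ n := by
  ext x y
  simp [tensorPower_apply, conjTranspose_apply]

theorem tensorPower_mul [Fintype ι] [DecidableEq ι] (A B : Matrix ι ι ℂ) (n : ℕ) :
    tensorPower A n * tensorPower B n = tensorPower (A * B) n := by
  ext x y
  simp only [mul_apply, tensorPower_apply, ← Finset.prod_mul_distrib]
  rw [Finset.prod_univ_sum, Fintype.piFinset_univ]

theorem tensorPower_trace [Fintype ι] [DecidableEq ι] (A : Matrix ι ι ℂ) (n : ℕ) :
    (tensorPower A n).trace = A.trace ^ n := by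
  have h := Finset.prod_univ_sum (fun _ : Fin n => (Finset.univ : Finset ι)) (fun _ i => A i i)
  rw [Fintype.piFinset_univ] at h
  simpa [trace, tensorPower_apply] using h.symm

end TensorPower

/-! ### Trace inequalities and the polar decomposition. -/

section Trace

variable {ι : Type*} [Fintype ι]

/-- Cauchy–Schwarz for the positive semidefinite form `(A, B) ↦ Re tr (Aᴴ E B)`. -/
theorem re_trace_sq_le {E : Matrix ι ι ℂ} (hE : E.PosSemidef) (A B : Matrix ι ι ℂ) :
    (Aᴴ * E * B).trace.re ^ 2 ≤ (Aᴴ * E * A).trace.re * (Bᴴ * E * B).trace.re := by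
  have hsymm : (Bᴴ * E * A).trace.re = (Aᴴ * E * B).trace.re := by
    have h : (Aᴴ * E * B)ᴴ = Bᴴ * E * A := by
      simp [conjTranspose_mul, hE.isHermitian.eq, Matrix.mul_assoc]
    rw [← h, trace_conjTranspose]
    simp
  have key (t : ℝ) : 0 ≤ (Bᴴ * E * B).trace.re * (t * t) + (2 * (Aᴴ * E * B).trace.re) * t
      + (Aᴴ * E * A).trace.re := by
    have h := (hE.conjTranspose_mul_mul_same (A + (t : ℂ) • B)).trace_nonneg
    have h' := (Complex.le_def.1 h).1
    simp only [conjTranspose_add, conjTranspose_smul, Matrix.add_mul, Matrix.mul_add, trace_add,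
      Matrix.smul_mul, Matrix.mul_smul, trace_smul, Complex.add_re, smul_eq_mul,
      RCLike.star_def, Complex.conj_ofReal, Complex.re_ofReal_mul, Complex.zero_re, hsymm] at h'
    linarith
  have := discrim_le_zero key
  rw [discrim] at this
  nlinarith

variable [DecidableEq ι]

theorem re_trace_mul_le_of_isProj {P X : Matrix ι ι ℂ} (hP : Pᴴ = P) (hPP : P * P = P)
    (hX : X.PosSemidef) : (P * X).trace.re ≤ X.trace.re := by
  have hQ : (1 - P)ᴴ * (1 - P) = 1 - P := by
    simp [hP, Matrix.mul_sub, Matrix.sub_mul, hPP]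
  have h := (hX.mul_mul_conjTranspose_same (1 - P)).trace_nonneg
  rw [trace_mul_comm, ← Matrix.mul_assoc, hQ] at h
  have h' := (Complex.le_def.1 h).1
  simp only [Matrix.sub_mul, Matrix.one_mul, trace_sub, Complex.sub_re, Complex.zero_re] at h'
  linarith

/-- The trace norm is the trace against a partial isometry. -/
theorem exists_partialIsometry_traceNorm (A : Matrix ι ι ℂ) :
    ∃ V P : Matrix ι ι ℂ, V * Vᴴ = P ∧ Pᴴ = P ∧ P * P = P ∧ (V * A).trace = traceNorm A := by
  set M := Aᴴ * A with hM
  have hMpos : M.PosSemidef := posSemidef_conjTranspose_mul_self A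
  have hM0 : 0 ≤ M := hMpos.nonneg
  have hMsa : IsSelfAdjoint M := hMpos.isHermitian
  have hc (f : ℝ → ℝ) : ContinuousOn f (spectrum ℝ M) :=
    (Matrix.finite_real_spectrum (A := M)).continuousOn f
  -- As `0⁻¹ = 0`, `W` is the pseudo-inverse of `√M`, and `√t * f t` is the indicator of `t > 0`, so
  -- `P` is the support projection of `M`.
  let f : ℝ → ℝ := fun t => (Real.sqrt t)⁻¹
  let W := cfc f M
  have hW : Wᴴ = W := (cfc_predicate f M : IsSelfAdjoint _)
  have hWM : W * M = cfc Real.sqrt M := by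
    conv_lhs => rw [show M = cfc (fun t : ℝ => t) M from (cfc_id' ℝ M hMsa).symm]
    rw [← cfc_mul f _ M (hc _) (hc _)]
    refine cfc_congr fun t ht => ?_
    simp only [f]
    rw [inv_mul_eq_div, Real.div_sqrt]
  have hWMW : W * M * W = cfc (fun t => Real.sqrt t * f t) M := by
    rw [hWM, ← cfc_mul _ f M (hc _) (hc _)]
  refine ⟨W * Aᴴ, cfc (fun t => Real.sqrt t * f t) M, ?_, ?_, ?_, ?_⟩
  · rw [conjTranspose_mul, conjTranspose_conjTranspose, hW, ← hWMW, hM]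
    simp only [Matrix.mul_assoc]
  · exact (cfc_predicate (fun t : ℝ => Real.sqrt t * f t) M : IsSelfAdjoint _)
  · rw [← cfc_mul _ _ M (hc _) (hc _)]
    refine cfc_congr fun t ht => ?_
    simp only [f]
    by_cases h : Real.sqrt t = 0 <;> simp [h]
  · have hsqrt : CFC.sqrt M = cfc Real.sqrt M := by
      rw [CFC.sqrt_eq_real_sqrt M hM0, cfcₙ_eq_cfc (hf := Real.continuous_sqrt.continuousOn)]
    have h0 : 0 ≤ (CFC.sqrt M).trace := (CFC.sqrt_nonneg M).posSemidef.trace_nonneg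
    rw [Matrix.mul_assoc, ← hM, hWM, ← hsqrt, traceNorm, ← hM]
    exact Complex.ext rfl (Complex.le_def.1 h0).2.symm

end Trace

/-- Here `a`, `b` are the two conditional error probabilities and `x`, `y` the two parts of the
overlap. With `u`, `v` as below, the right side is `u + v + p * (1 - p) * ((1 - a) * b + a * (1 -
b))`; the cross term in `x * y` is at most `2 * √(u * v) ≤ u + v`. -/
theorem prior_mul_sq_le {p a b x y : ℝ} (hp₀ : 0 ≤ p) (hp₁ : p ≤ 1) (ha₀ : 0 ≤ a) (ha₁ : a ≤ 1)
    (hb₀ : 0 ≤ b) (hb₁ : b ≤ 1) (hx : x ^ 2 ≤ (1 - a) * b) (hy : y ^ 2 ≤ a * (1 - b)) :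
    p * (1 - p) * (x + y) ^ 2 ≤
      (p * a + (1 - p) * b) * (1 - (p * a + (1 - p) * b)) := by
  have hq : 0 ≤ 1 - p := by linarith
  have ha : 0 ≤ 1 - a := by linarith
  have hb : 0 ≤ 1 - b := by linarith
  set u := p ^ 2 * (a * (1 - a)) with hu
  set v := (1 - p) ^ 2 * (b * (1 - b)) with hv
  have hu₀ : 0 ≤ u := by positivity
  have hv₀ : 0 ≤ v := by positivity
  have hpq : 0 ≤ p * (1 - p) := mul_nonneg hp₀ hq
  have hxy : (2 * (p * (1 - p)) * (x * y)) ^ 2 ≤ (u + v) ^ 2 := by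
    have h : x ^ 2 * y ^ 2 ≤ ((1 - a) * b) * (a * (1 - b)) :=
      mul_le_mul hx hy (sq_nonneg _) (by positivity)
    calc (2 * (p * (1 - p)) * (x * y)) ^ 2 = 4 * (p * (1 - p)) ^ 2 * (x ^ 2 * y ^ 2) := by ring
      _ ≤ 4 * (p * (1 - p)) ^ 2 * (((1 - a) * b) * (a * (1 - b))) := by gcongr
      _ = 4 * (u * v) := by rw [hu, hv]; ring
      _ ≤ (u + v) ^ 2 := by nlinarith [sq_nonneg (u - v)]
  have h1 := abs_le_of_sq_le_sq' hxy (by positivity)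
  have h2 := mul_le_mul_of_nonneg_left hx hpq
  have h3 := mul_le_mul_of_nonneg_left hy hpq
  calc p * (1 - p) * (x + y) ^ 2
      = p * (1 - p) * x ^ 2 + p * (1 - p) * y ^ 2 + 2 * (p * (1 - p)) * (x * y) := by ring
    _ ≤ p * (1 - p) * ((1 - a) * b) + p * (1 - p) * (a * (1 - b)) + (u + v) := by linarith [h1.2]
    _ = _ := by rw [hu, hv]; ring

/-! ### The bound for one pair of states and one test. -/

section OneShot

variable {κ : Type*} [Fintype κ] [DecidableEq κ]

/-- After Cauchy–Schwarz, `V` survives only as the projection `V * Vᴴ`, which can only decrease the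
trace of `S * E * S`. -/
theorem re_trace_mul_mul_sq_le {E R S V P : Matrix κ κ ℂ} (hE : E.PosSemidef) (hR : Rᴴ = R)
    (hS : Sᴴ = S) (hVP : V * Vᴴ = P) (hP : Pᴴ = P) (hPP : P * P = P) :
    (R * E * (S * V)).trace.re ^ 2 ≤ (E * (R * R)).trace.re * (E * (S * S)).trace.re := by
  have h := re_trace_sq_le hE R (S * V)
  have hR' : (Rᴴ * E * R).trace = (E * (R * R)).trace := by
    rw [hR, Matrix.mul_assoc, trace_mul_comm, Matrix.mul_assoc]
  have hpos : (S * E * S).PosSemidef := by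
    simpa [hS] using hE.mul_mul_conjTranspose_same S
  have hS' : ((S * V)ᴴ * E * (S * V)).trace = (P * (S * E * S)).trace := by
    rw [conjTranspose_mul, hS, ← hVP, Matrix.mul_assoc V, trace_mul_comm V]
    simp only [Matrix.mul_assoc]
  have hS'' : (S * E * S).trace = (E * (S * S)).trace := by
    rw [Matrix.mul_assoc, trace_mul_comm, Matrix.mul_assoc]
  have hle := re_trace_mul_le_of_isProj hP hPP hpos
  have hnn : 0 ≤ (E * (R * R)).trace.re := by
    rw [← hR']
    exact (Complex.le_def.1 (hE.conjTranspose_mul_mul_same R).trace_nonneg).1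
  rw [hR', hS'] at h
  rw [hR] at h
  rw [hS''] at hle
  exact h.trans (mul_le_mul_of_nonneg_left hle hnn)

omit [DecidableEq κ] in
theorem re_trace_mul_sq_nonneg {E R : Matrix κ κ ℂ} (hE : E.PosSemidef) (hR : Rᴴ = R) :
    0 ≤ (E * (R * R)).trace.re := by
  have h := (hE.conjTranspose_mul_mul_same R).trace_nonneg
  rw [hR, Matrix.mul_assoc, trace_mul_comm, Matrix.mul_assoc] at h
  exact (Complex.le_def.1 h).1

theorem prior_mul_re_trace_sq_le (E : Effect κ) {R S V P : Matrix κ κ ℂ} (hR : Rᴴ = R)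
    (hS : Sᴴ = S) (hVP : V * Vᴴ = P) (hP : Pᴴ = P) (hPP : P * P = P)
    (hR₁ : (R * R).trace = 1) (hS₁ : (S * S).trace = 1) {p : ℝ} (hp₀ : 0 ≤ p) (hp₁ : p ≤ 1) :
    p * (1 - p) * (V * (R * S)).trace.re ^ 2 ≤
      errorProb E p (R * R) (S * S) * (1 - errorProb E p (R * R) (S * S)) := by
  have hE := E.2.1
  have hE' := E.2.2
  have cR : (E.1 * (R * R)).trace.re = 1 - ((1 - E.1) * (R * R)).trace.re := by
    simp [Matrix.sub_mul, hR₁]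
  have cS : ((1 - E.1) * (S * S)).trace.re = 1 - (E.1 * (S * S)).trace.re := by
    simp [Matrix.sub_mul, hS₁]
  have hx := re_trace_mul_mul_sq_le hE hR hS hVP hP hPP
  have hy := re_trace_mul_mul_sq_le hE' hR hS hVP hP hPP
  have a0 := re_trace_mul_sq_nonneg hE' hR
  have b0 := re_trace_mul_sq_nonneg hE hS
  have a1 := re_trace_mul_sq_nonneg hE hR
  have b1 := re_trace_mul_sq_nonneg hE' hS
  rw [cR] at hx a1
  rw [cS] at hy b1
  have hsum : (V * (R * S)).trace.re
      = (R * E.1 * (S * V)).trace.re + (R * (1 - E.1) * (S * V)).trace.re := by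
    rw [trace_mul_comm, ← Complex.add_re, ← trace_add, ← Matrix.add_mul, ← Matrix.mul_add]
    simp [Matrix.mul_assoc]
  rw [hsum]
  exact prior_mul_sq_le hp₀ hp₁ a0 (by linarith) b0 (by linarith) hx hy

end OneShot

/-! ### Many copies, and the min-max error. -/

section Fidelity

variable {ι : Type*} [Fintype ι] [DecidableEq ι]

theorem prior_mul_fidelity_pow_le {ρ σ : Matrix ι ι ℂ} (hρ : IsState ρ) (hσ : IsState σ) {n : ℕ}
    (E : Effect (Fin n → ι)) {p : ℝ} (hp₀ : 0 ≤ p) (hp₁ : p ≤ 1) :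
    p * (1 - p) * fidelity ρ σ ^ (2 * n) ≤
      errorProb E p (tensorPower ρ n) (tensorPower σ n) *
        (1 - errorProb E p (tensorPower ρ n) (tensorPower σ n)) := by
  obtain ⟨V, P, hVP, hP, hPP, hV⟩ := exists_partialIsometry_traceNorm (CFC.sqrt ρ * CFC.sqrt σ)
  have hR : (CFC.sqrt ρ)ᴴ = CFC.sqrt ρ := (CFC.sqrt_nonneg ρ).posSemidef.isHermitian
  have hS : (CFC.sqrt σ)ᴴ = CFC.sqrt σ := (CFC.sqrt_nonneg σ).posSemidef.isHermitian
  have hRR : CFC.sqrt ρ * CFC.sqrt ρ = ρ := CFC.sqrt_mul_sqrt_self ρ hρ.1.nonneg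
  have hSS : CFC.sqrt σ * CFC.sqrt σ = σ := CFC.sqrt_mul_sqrt_self σ hσ.1.nonneg
  have h := prior_mul_re_trace_sq_le E (R := tensorPower (CFC.sqrt ρ) n)
    (S := tensorPower (CFC.sqrt σ) n) (V := tensorPower V n) (P := tensorPower P n)
    (by rw [tensorPower_conjTranspose, hR]) (by rw [tensorPower_conjTranspose, hS])
    (by rw [tensorPower_conjTranspose, tensorPower_mul, hVP])
    (by rw [tensorPower_conjTranspose, hP]) (by rw [tensorPower_mul, hPP])
    (by rw [tensorPower_mul, hRR, tensorPower_trace, hρ.2, one_pow])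
    (by rw [tensorPower_mul, hSS, tensorPower_trace, hσ.2, one_pow]) hp₀ hp₁
  simp only [tensorPower_mul, hRR, hSS, tensorPower_trace, hV] at h
  rw [← Complex.ofReal_pow, Complex.ofReal_re, ← pow_mul, mul_comm n 2] at h
  exact h

theorem fidelity_nonneg (ρ σ : Matrix ι ι ℂ) : 0 ≤ fidelity ρ σ :=
  (Complex.le_def.1 (CFC.sqrt_nonneg _).posSemidef.trace_nonneg).1

theorem errorProb_mem_Icc {κ : Type*} [Fintype κ] [DecidableEq κ] (E : Effect κ)
    {ρ σ : Matrix κ κ ℂ} (hρ : IsState ρ) (hσ : IsState σ) {p : ℝ} (hp₀ : 0 ≤ p) (hp₁ : p ≤ 1) :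
    errorProb E p ρ σ ∈ Set.Icc 0 1 := by
  have nn (F τ : Matrix κ κ ℂ) (hF : F.PosSemidef) (hτ : IsState τ) : 0 ≤ (F * τ).trace.re := by
    rw [← CFC.sqrt_mul_sqrt_self τ hτ.1.nonneg]
    exact re_trace_mul_sq_nonneg hF (CFC.sqrt_nonneg τ).posSemidef.isHermitian
  have h1 := nn _ _ E.2.1 hρ
  have h2 := nn _ _ E.2.2 hρ
  have h3 := nn _ _ E.2.1 hσ
  have h4 := nn _ _ E.2.2 hσ
  have cR : (E.1 * ρ).trace.re = 1 - ((1 - E.1) * ρ).trace.re := by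
    simp [Matrix.sub_mul, hρ.2]
  have cS : ((1 - E.1) * σ).trace.re = 1 - (E.1 * σ).trace.re := by
    simp [Matrix.sub_mul, hσ.2]
  rw [errorProb]
  constructor <;> nlinarith

theorem IsState.tensorPower {ρ : Matrix ι ι ℂ} (hρ : IsState ρ) (n : ℕ) :
    IsState (tensorPower ρ n) := by
  refine ⟨?_, by rw [tensorPower_trace, hρ.2, one_pow]⟩
  have hR : (CFC.sqrt ρ)ᴴ = CFC.sqrt ρ := (CFC.sqrt_nonneg ρ).posSemidef.isHermitian
  have h := posSemidef_conjTranspose_mul_self (CompositeQHT.tensorPower (CFC.sqrt ρ) n)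
  rwa [tensorPower_conjTranspose, tensorPower_mul, hR,
    CFC.sqrt_mul_sqrt_self ρ hρ.1.nonneg] at h

instance : Nonempty (Effect ι) := ⟨⟨0, PosSemidef.zero, by simpa using PosSemidef.one⟩⟩

theorem fidelity_le_one {ρ σ : Matrix ι ι ℂ} (hρ : IsState ρ) (hσ : IsState σ) :
    fidelity ρ σ ≤ 1 := by
  obtain ⟨E⟩ : Nonempty (Effect (Fin 1 → ι)) := inferInstance
  have h := prior_mul_fidelity_pow_le hρ hσ E (p := 1 / 2) (by norm_num) (by norm_num)
  set e := errorProb E (1 / 2) (tensorPower ρ 1) (tensorPower σ 1)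
  have : fidelity ρ σ ^ 2 ≤ 1 := by
    rw [mul_one] at h
    nlinarith [sq_nonneg (e - 1 / 2)]
  exact (sq_le_one_iff₀ (fidelity_nonneg ρ σ)).1 this

/-- The two-point lower bound on the min-max error. -/
theorem prior_mul_fidelity_pow_le_of_minErrorProb_le {D₁ D₂ : Set (Matrix ι ι ℂ)}
    (hs₁ : ∀ ρ ∈ D₁, IsState ρ) (hs₂ : ∀ ρ ∈ D₂, IsState ρ) {p δ : ℝ} (hp₀ : 0 ≤ p) (hp₁ : p ≤ 1)
    (hδ : δ ≤ 1 / 2) {n : ℕ} (hn : minErrorProb n p D₁ D₂ ≤ δ) {ρ σ : Matrix ι ι ℂ}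
    (hρ : ρ ∈ D₁) (hσ : σ ∈ D₂) :
    p * (1 - p) * fidelity ρ σ ^ (2 * n) ≤ δ * (1 - δ) := by
  set c := p * (1 - p) * fidelity ρ σ ^ (2 * n) with hc
  -- The smaller root of `e * (1 - e) = c` bounds every test's error from below, so the bound
  -- survives the infimum without a minimizing test.
  have hlow : (1 - Real.sqrt (1 - 4 * c)) / 2 ≤ minErrorProb n p D₁ D₂ := by
    refine le_ciInf fun E => ?_
    have hbdd : BddAbove (Set.range fun r : D₁ × D₂ =>
        errorProb E p (tensorPower r.1.1 n) (tensorPower r.2.1 n)) := by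
      refine ⟨1, ?_⟩
      rintro _ ⟨r, rfl⟩
      exact (errorProb_mem_Icc E ((hs₁ _ r.1.2).tensorPower n) ((hs₂ _ r.2.2).tensorPower n)
        hp₀ hp₁).2
    refine le_trans ?_ (le_ciSup hbdd (⟨ρ, hρ⟩, ⟨σ, hσ⟩))
    have h := prior_mul_fidelity_pow_le (hs₁ _ hρ) (hs₂ _ hσ) E hp₀ hp₁
    rw [← hc] at h
    dsimp only
    set e := errorProb E p (tensorPower ρ n) (tensorPower σ n)
    have : 1 - 2 * e ≤ Real.sqrt (1 - 4 * c) := Real.le_sqrt_of_sq_le (by nlinarith)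
    linarith
  -- Excludes the default value `0` of `Real.sqrt` on negative reals.
  have h4c : 4 * c ≤ 1 := by
    obtain ⟨E⟩ : Nonempty (Effect (Fin n → ι)) := inferInstance
    have h := prior_mul_fidelity_pow_le (hs₁ _ hρ) (hs₂ _ hσ) E hp₀ hp₁
    rw [← hc] at h
    nlinarith [sq_nonneg (errorProb E p (tensorPower ρ n) (tensorPower σ n) - 1 / 2)]
  have hsq : Real.sqrt (1 - 4 * c) ^ 2 = 1 - 4 * c := Real.sq_sqrt (by linarith)
  have hle : 1 - 2 * δ ≤ Real.sqrt (1 - 4 * c) := by linarith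
  -- Squaring `hle` is legitimate because `δ ≤ 1 / 2`.
  nlinarith [Real.sqrt_nonneg (1 - 4 * c), hlow.trans hn]

end Fidelity

theorem extDiv_coe_le {a b : ℝ} {n : ℕ} (hb : 0 ≤ b) (h : a ≤ n * b) :
    extDiv a (b : EReal) ≤ ((n : ℝ) : EReal) := by
  -- If `b = 0`, then `h` forces `a ≤ 0`, so the quotient is `0` and not `⊤`.
  rcases hb.eq_or_lt with rfl | hb
  · have ha : ¬ 0 < a := by simpa using h
    simp [extDiv, ha]
  · have hb' : ¬ ((b : EReal) = 0 ∧ 0 < a) := fun h' => hb.ne' (by exact_mod_cast h'.1)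
    rw [extDiv, if_neg hb', ← EReal.coe_div, EReal.coe_le_coe_iff]
    exact (div_le_iff₀ hb).2 h

theorem extDiv_log_le {x F : ℝ} {n : ℕ} (hx : 0 < x) (hF₀ : 0 ≤ F) (hF₁ : F ≤ 1)
    (h : x * F ^ (2 * n) ≤ 1) :
    extDiv (Real.log x) (-2 * extLog F) ≤ ((n : ℝ) : EReal) := by
  rcases hF₀.eq_or_lt with rfl | hF₀
  · have htop : (-2 : EReal) * ⊥ = ⊤ := EReal.coe_mul_bot_of_neg (x := -2) (by norm_num)
    simp [extDiv, extLog, htop]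
  · have hcoe : -2 * extLog F = ((-2 * Real.log F : ℝ) : EReal) := by
      rw [extLog, ENNReal.log_ofReal_of_pos hF₀]
      rfl
    rw [hcoe]
    refine extDiv_coe_le (by linarith [Real.log_nonpos hF₀.le hF₁]) ?_
    have h' := Real.log_nonpos (by positivity) h
    rw [Real.log_mul hx.ne' (by positivity), Real.log_pow] at h'
    push_cast at h'
    linarith

/-! ### From pairs of states to sets. -/

section Sets

variable {ι : Type*} [Fintype ι] [DecidableEq ι] {D₁ D₂ : Set (Matrix ι ι ℂ)}

theorem maxFidelity_pow_le (hne₁ : D₁.Nonempty) (hne₂ : D₂.Nonempty) {m : ℕ} (hm : m ≠ 0) {c : ℝ}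
    (hc : 0 ≤ c) (h : ∀ ρ ∈ D₁, ∀ σ ∈ D₂, fidelity ρ σ ^ m ≤ c) : maxFidelity D₁ D₂ ^ m ≤ c := by
  have : Nonempty (D₁ × D₂) := ⟨⟨_, hne₁.some_mem⟩, ⟨_, hne₂.some_mem⟩⟩
  have hroot : (c ^ (m : ℝ)⁻¹) ^ m = c := Real.rpow_inv_natCast_pow hc hm
  have hle : maxFidelity D₁ D₂ ≤ c ^ (m : ℝ)⁻¹ := by
    refine ciSup_le fun r => le_of_pow_le_pow_left₀ hm (by positivity) ?_
    rw [hroot]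
    exact h _ r.1.2 _ r.2.2
  have hnn : 0 ≤ maxFidelity D₁ D₂ := Real.iSup_nonneg fun r => fidelity_nonneg _ _
  exact (pow_le_pow_left₀ hnn hle m).trans_eq hroot

theorem one_sub_le_mul_buresDist_sq {ρ σ : Matrix ι ι ℂ} {n : ℕ} {c : ℝ}
    (h : fidelity ρ σ ^ (2 * n) ≤ c) : 1 - c ≤ n * buresDist ρ σ ^ 2 := by
  have hb : 2 * (1 - fidelity ρ σ) ≤ buresDist ρ σ ^ 2 := by
    -- The square is a maximum with `0`, so `fidelity ρ σ ≤ 1` is not needed.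
    rw [buresDist, Real.sq_sqrt']
    exact le_max_left _ _
  have hF := one_add_mul_le_pow (a := fidelity ρ σ - 1)
    (by linarith [fidelity_nonneg ρ σ]) (2 * n)
  rw [add_sub_cancel] at hF
  push_cast at hF
  have := mul_le_mul_of_nonneg_left hb (Nat.cast_nonneg (α := ℝ) n)
  linarith

theorem one_sub_le_mul_infSqBuresDist (hne₁ : D₁.Nonempty) (hne₂ : D₂.Nonempty) {n : ℕ}
    (hn : 1 ≤ n) {c : ℝ} (h : ∀ ρ ∈ D₁, ∀ σ ∈ D₂, fidelity ρ σ ^ (2 * n) ≤ c) :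
    1 - c ≤ n * infSqBuresDist D₁ D₂ := by
  have : Nonempty (D₁ × D₂) := ⟨⟨_, hne₁.some_mem⟩, ⟨_, hne₂.some_mem⟩⟩
  have hn' : (0 : ℝ) < n := by exact_mod_cast hn
  rw [← div_le_iff₀' hn']
  refine le_ciInf fun r => ?_
  rw [div_le_iff₀' hn']
  exact one_sub_le_mul_buresDist_sq (h _ r.1.2 _ r.2.2)

theorem le_sampleComplexity {p δ : ℝ} {x : EReal}
    (h : ∀ n : ℕ, 1 ≤ n → minErrorProb n p D₁ D₂ ≤ δ → x ≤ ((n : ℝ) : EReal)) :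
    x ≤ ((sampleComplexity p D₁ D₂ δ : ENNReal) : EReal) := by
  rcases Set.eq_empty_or_nonempty
    {N : ℕ∞ | ∃ n : ℕ, 1 ≤ n ∧ minErrorProb n p D₁ D₂ ≤ δ ∧ N = n} with he | hne
  · simp [sampleComplexity, he]
  -- The infimum is attained because `ℕ∞` is well-ordered.
  · obtain ⟨n, hn, hle, hN⟩ := csInf_mem hne
    rw [sampleComplexity, hN]
    rw [ENat.toENNReal_coe]
    exact h n hn hle

end Sets

end CompositeQHT

theorem mainTheorem3 {d : ℕ} (D₁ D₂ : Set (Matrix (Fin d) (Fin d) ℂ))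
    (hne₁ : D₁.Nonempty) (hne₂ : D₂.Nonempty)
    (hc₁ : IsCompact D₁) (hc₂ : IsCompact D₂)
    (hs₁ : ∀ ρ ∈ D₁, CompositeQHT.IsState ρ) (hs₂ : ∀ ρ ∈ D₂, CompositeQHT.IsState ρ)
    (p δ : ℝ) (hp₀ : 0 < p) (hp₁ : p < 1) (hδ₀ : 0 < δ) (hδ₁ : δ ≤ 1 / 2) :
    max
      (CompositeQHT.extDiv (Real.log (p * (1 - p) / δ))
        (-2 * CompositeQHT.extLog (CompositeQHT.maxFidelity D₁ D₂)))
      (CompositeQHT.extDiv (1 - δ * (1 - δ) / (p * (1 - p)))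
        (CompositeQHT.infSqBuresDist D₁ D₂ : EReal))
      ≤ ((CompositeQHT.sampleComplexity p D₁ D₂ δ : ENNReal) : EReal) := by
  open CompositeQHT in
  refine le_sampleComplexity fun n hn hle => ?_
  have hpq : 0 < p * (1 - p) := mul_pos hp₀ (by linarith)
  have hδ : 0 < δ * (1 - δ) := mul_pos hδ₀ (by linarith)
  have hF : ∀ ρ ∈ D₁, ∀ σ ∈ D₂, fidelity ρ σ ^ (2 * n) ≤ δ * (1 - δ) / (p * (1 - p)) :=
    fun ρ hρ σ hσ => (le_div_iff₀' hpq).2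
      (prior_mul_fidelity_pow_le_of_minErrorProb_le hs₁ hs₂ hp₀.le hp₁.le hδ₁ hle hρ hσ)
  refine max_le ?_ ?_
  · have hmax := maxFidelity_pow_le hne₁ hne₂ (by omega) (by positivity) hF
    have h0 : 0 ≤ maxFidelity D₁ D₂ := Real.iSup_nonneg fun r => fidelity_nonneg _ _
    have h1 : maxFidelity D₁ D₂ ≤ 1 :=
      Real.iSup_le (fun r => fidelity_le_one (hs₁ _ r.1.2) (hs₂ _ r.2.2)) zero_le_one
    refine extDiv_log_le (by positivity) h0 h1 ?_
    rw [div_mul_eq_mul_div, div_le_one hδ₀]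
    rw [le_div_iff₀' hpq] at hmax
    -- The factor `1 - δ ≤ 1` is discarded here.
    nlinarith
  · exact extDiv_coe_le (Real.iInf_nonneg fun r => sq_nonneg _)
      (one_sub_le_mul_infSqBuresDist hne₁ hne₂ hn hF)
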